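/- There is a universal constant $C>0$ such that the following holds. Let $d\ge 0$ and $K\ge 1$ be integers, let $B>0$, and let $\alpha=(\alpha_1,\dots,\alpha_d)$ be a sorted vector with $B\ge\alpha_1\ge\cdots\ge\alpha_d\ge 0$ and $\sum_{i=1}^d\alpha_i\le 1$. Write $p_k(\alpha)=\sum_{i=1}^d\alpha_i^k$ and $d_{\mathrm{TV}}(x,y)=\frac12\sum_{i=1}^d|x_i-y_i|$. Suppose that real numbers $\widehat p_k, V_k$ $(1\le k\le K)$ satisfy $|\widehat p_k-p_k(\alpha)|\le V_k$ for all $k\in\{1,\dots,K\}$. Consider the following randomized algorithm, whose input is $d,K,B,(\widehat p_k)_{k\le K},(V_k)_{k\le K}$ (but not $\alpha$). 1. (Linear program.) Find a nonnegative measure $\widehat\mu$ on $[0,B]$ with $\widehat\mu([0,B])=d$ and $\bigl|\widehat p_k-\int_0^B x^k\,\widehat\mu(\mathrm dx)\bigr|\le V_k$ for all $k\in\{1,\dots,K\}$. 2. (Randomized rounding.) Let $Q(t)=\inf\{x\in\mathbb R: \widehat\mu((-\infty,x])\ge t\}$ for $0<t\le d$ be the quantile function of $\widehat\mu$ (with $Q(0)=0$).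 Draw $u_1,\dots,u_d$ independently and uniformly from $[0,1]$ and output $\widehat{\alpha}=(\widehat\alpha_1,\dots,\widehat\alpha_d)$ with $\widehat\alpha_i=Q(d-i+u_i)$. Then the linear program is feasible, and for every feasible solution $\widehat\mu$ found in step 1, the output $\widehat\alpha$ is a measurable function of $(u_1,\dots,u_d)$, is always sorted ($\widehat\alpha_1\ge\cdots\ge\widehat\alpha_d$), $d_{\mathrm{TV}}(\widehat\alpha,\alpha)$ is integrable, and $$\mathbb E\, d_{\mathrm{TV}}(\widehat\alpha,\alpha)\le C\Bigl(\frac{\sqrt{Bd}}{K}+2^{9K/2}\,B\sum_{k=1}^K B^{-k}V_k\Bigr).$$ Moreover, the first term can be replaced by $\sqrt{Bd\,(p_1(\alpha)+V_1)}/K$: $$\mathbb E\, d_{\mathrm{TV}}(\widehat\alpha,\alpha)\le C\Bigl(\frac{\sqrt{Bd\,(p_1(\alpha)+V_1)}}{K}+2^{9K/2}\,B\sum_{k=1}^K B^{-k}V_k\Bigr).$$ -/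

import Mathlib

open MeasureTheory

namespace LocalMomentMatching

/-- Total variation distance between two vectors of the same length. -/
noncomputable def dTV {d : ℕ} (x y : Fin d → ℝ) : ℝ :=
  (1 / 2) * ∑ i, |x i - y i|

/-- The power sum `p_k(x) = ∑ i, x_i ^ k`. -/
def powerSum {d : ℕ} (k : ℕ) (x : Fin d → ℝ) : ℝ :=
  ∑ i, x i ^ k

/-- `μ` is a feasible solution of the (semi-infinite) linear program with data `d, B, K, p, V`:
a nonnegative measure on `[0, B]` of total mass `d` whose `k`-th moment is within `V k` of `p k`
for every `k` in `{1, ..., K}`. Only the entries `p k` and `V k` with `1 ≤ k ≤ K` are read. -/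
structure IsLPSolution (d : ℕ) (B : ℝ) (K : ℕ) (p V : ℕ → ℝ) (μ : Measure ℝ) : Prop where
  supported : μ (Set.Icc 0 B)ᶜ = 0
  mass : μ (Set.Icc 0 B) = d
  moments : ∀ k ∈ Finset.Icc 1 K, |p k - ∫ x in Set.Icc 0 B, x ^ k ∂μ| ≤ V k

/-- The quantile function of a finite measure on the line (not normalized):
the least `x` with `μ (-∞, x] ≥ t`, for `0 < t ≤ μ ℝ`. -/
noncomputable def quantile (μ : Measure ℝ) (t : ℝ) : ℝ :=
  sInf {x : ℝ | t ≤ μ.real (Set.Iic x)}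

/-- Randomized rounding of a measure `μ` of total mass `d` to a vector of length `d`.
Cut `μ`, from the right to the left, into `d` consecutive pieces of mass one; the `i`-th output
coordinate is drawn from the `i`-th piece. The random seed `u` consists of `d` independent uniform
samples from `[0, 1]`, i.e. its law is `volume` on `Fin d → unitInterval`; since indices start at
`0`, the `i`-th piece carries the quantile levels from `d - 1 - i` to `d - i`. -/
noncomputable def round (d : ℕ) (μ : Measure ℝ) (u : Fin d → unitInterval) : Fin d → ℝ :=
  fun i => quantile μ ((d : ℝ) - 1 - (i : ℝ) + (u i : ℝ))

end LocalMomentMatching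

/-!
Let `μ` be a feasible solution and `ν = ∑ i, δ_{α i}`. Rounding couples `μ` with `ν` through their
quantile functions, and in one dimension this coupling is optimal: the expected distance equals
`1 / 2 * (∫ f dμ - ∫ f dν)` for some 1-Lipschitz `f` with `f 0 = 0`.

Put `g θ = f (B (1 - cos θ) / 2)`. Convolving `g` with the Fejér–Korovkin kernel of degree `K` gives
a polynomial in `x = B (1 - cos θ) / 2`. Subtracting its constant term turns the error into an
average over the kernel of the second difference `g (t + θ) - g t - g θ + g 0`, which is at most
`4 B |sin (θ / 2)| |sin (t / 2)|`. Since `√B |sin (θ / 2)| = √x` and the kernel gives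
`|sin (t / 2)|` a mean of order `1 / K`, the error is `O(√(B x) / K)`, and the resulting polynomial
`P` has coefficients `|P_k| ≤ 14 ^ K * B ^ (1 - k)`.

The `k`-th moments of `μ` and `ν` both lie within `V k` of `p k`, which bounds `∫ P dμ - ∫ P dν`,
and Cauchy–Schwarz bounds the approximation error through `∫ √x dμ ≤ √(d * ∫ x dμ)`. When `V 1 ≥ 1`,
the form of the bound without the first moment follows from the trivial bound `p_1(α) + V 1`.
-/

namespace LocalMomentMatching

open Polynomial Real
open scoped NNReal

theorem integral_mul_le_sqrt_mul_sqrt {Ω : Type*} [MeasurableSpace Ω] {μ : Measure Ω}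
    {f g : Ω → ℝ} (hf : MemLp f 2 μ) (hg : MemLp g 2 μ) :
    ∫ x, f x * g x ∂μ ≤ √(∫ x, f x ^ 2 ∂μ) * √(∫ x, g x ^ 2 ∂μ) := by
  have hölder := integral_mul_norm_le_Lp_mul_Lq (μ := μ) (f := f) (g := g)
    Real.HolderConjugate.two_two (by simpa using hf) (by simpa using hg)
  simp only [norm_eq_abs, rpow_two, sq_abs, ← sqrt_eq_rpow] at hölder
  refine le_trans (integral_mono (hf.integrable_mul hg) (hf.norm.integrable_mul hg.norm)
    fun x => ?_) hölder
  exact (le_abs_self _).trans (abs_mul _ _).le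

section Chebyshev

theorem abs_coeff_chebyshev_T_comp_le_seven_pow (m k : ℕ) :
    |((Chebyshev.T ℝ m).comp (1 - 2 * X)).coeff k| ≤ 7 ^ m := by
  induction m using Nat.twoStepInduction generalizing k with
  | zero =>
    simp only [Nat.cast_zero, Chebyshev.T_zero, one_comp, coeff_one]
    split_ifs <;> simp
  | one =>
    simp only [Nat.cast_one, Chebyshev.T_one, X_comp, coeff_sub, coeff_one, coeff_ofNat_mul,
      coeff_X]
    split_ifs <;> norm_num
  | more m ih₀ ih₁ =>
    set T₀ := (Chebyshev.T ℝ (m : ℕ)).comp (1 - 2 * X)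
    set T₁ := (Chebyshev.T ℝ (m + 1 : ℕ)).comp (1 - 2 * X) with hT₁
    have recurrence : (Chebyshev.T ℝ (m + 2 : ℕ)).comp (1 - 2 * X) =
        C 2 * T₁ - C 4 * (T₁ * X) - T₀ := by
      push_cast [hT₁, Chebyshev.T_add_two]
      simp only [sub_comp, mul_comp, X_comp, ofNat_comp, map_ofNat]
      ring
    have shifted : |(T₁ * X).coeff k| ≤ 7 ^ (m + 1) := by
      cases k with
      | zero => simp
      | succ k => simpa only [coeff_mul_X] using ih₁ k
    calc |((Chebyshev.T ℝ (m + 2 : ℕ)).comp (1 - 2 * X)).coeff k|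
        = |2 * T₁.coeff k - 4 * (T₁ * X).coeff k - T₀.coeff k| := by
          rw [recurrence]; simp only [coeff_sub, coeff_C_mul]
      _ ≤ 2 * |T₁.coeff k| + 4 * |(T₁ * X).coeff k| + |T₀.coeff k| := by
          refine (abs_sub _ _).trans (add_le_add_left ((abs_sub _ _).trans ?_) _)
          simp only [abs_mul, Nat.abs_ofNat, le_refl]
      _ ≤ 2 * 7 ^ (m + 1) + 4 * 7 ^ (m + 1) + 7 ^ m := by
          gcongr
          exacts [ih₁ k, ih₀ k]
      _ ≤ 7 ^ (m + 2) := by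
          have : (0 : ℝ) < 7 ^ m := by positivity
          rw [pow_add, pow_add]
          linarith

end Chebyshev

section Kernel

theorem integral_cos_int_mul (m : ℤ) :
    ∫ t in -π..π, cos (m * t) = if m = 0 then 2 * π else 0 := by
  split_ifs with h
  · simp [h, two_mul]
  · have hm : (m : ℝ) ≠ 0 := by exact_mod_cast h
    simp [intervalIntegral.integral_comp_mul_left (fun x => cos x) hm]

theorem integral_cos_int_mul_mul_cos (m : ℤ) :
    ∫ t in -π..π, cos (m * t) * cos t =
      π * ((if m = 1 then 1 else 0) + if m = -1 then 1 else 0) := by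
  have product_to_sum : ∀ t : ℝ, cos (m * t) * cos t =
      1 / 2 * cos ((m + 1 : ℤ) * t) + 1 / 2 * cos ((m - 1 : ℤ) * t) := by
    intro t
    push_cast
    rw [add_mul, sub_mul, one_mul, cos_add, cos_sub]
    ring
  simp only [product_to_sum]
  rw [intervalIntegral.integral_add (Continuous.intervalIntegrable (by fun_prop) _ _)
    (Continuous.intervalIntegrable (by fun_prop) _ _), intervalIntegral.integral_const_mul,
    intervalIntegral.integral_const_mul, integral_cos_int_mul, integral_cos_int_mul]
  simp only [add_eq_zero_iff_eq_neg, sub_eq_zero]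
  split_ifs <;> ring

theorem sum_range_sum_range_ite_eq_succ (a : ℕ → ℝ) (n : ℕ) :
    ∑ j ∈ Finset.range (n + 1), ∑ k ∈ Finset.range (n + 1),
      (if j = k + 1 then a j * a k else 0) = ∑ k ∈ Finset.range n, a k * a (k + 1) := by
  rw [Finset.sum_comm, Finset.sum_range_succ]
  simp only [Finset.sum_ite_eq', Finset.mem_range, lt_irrefl, if_false, add_zero]
  refine Finset.sum_congr rfl fun k hk => ?_
  rw [if_pos (Nat.succ_lt_succ (Finset.mem_range.1 hk)), mul_comm]

variable (a : ℕ → ℝ) (n : ℕ)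

/-- The trigonometric kernel `|∑ j ≤ n, a j * exp (i j t)| ^ 2`, written out in real form: the
convolution kernel of a Jackson-type smoothing operator. It is not normalized. -/
noncomputable def squareKernel (t : ℝ) : ℝ :=
  (∑ j ∈ Finset.range (n + 1), a j * cos (j * t)) ^ 2 +
    (∑ j ∈ Finset.range (n + 1), a j * sin (j * t)) ^ 2

theorem squareKernel_nonneg (t : ℝ) : 0 ≤ squareKernel a n t := by
  unfold squareKernel
  positivity

@[fun_prop]
theorem continuous_squareKernel : Continuous (squareKernel a n) := by
  unfold squareKernel
  fun_prop

theorem squareKernel_eq_sum_cos (t : ℝ) :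
    squareKernel a n t = ∑ j ∈ Finset.range (n + 1), ∑ k ∈ Finset.range (n + 1),
      a j * a k * cos ((j - k : ℤ) * t) := by
  rw [squareKernel, sq, sq, Finset.sum_mul_sum, Finset.sum_mul_sum, ← Finset.sum_add_distrib]
  refine Finset.sum_congr rfl fun j _ => ?_
  rw [← Finset.sum_add_distrib]
  refine Finset.sum_congr rfl fun k _ => ?_
  push_cast
  rw [sub_mul, cos_sub]
  ring

theorem integral_squareKernel_mul {h : ℝ → ℝ} (hh : Continuous h) :
    ∫ t in -π..π, squareKernel a n t * h t =
      ∑ j ∈ Finset.range (n + 1), ∑ k ∈ Finset.range (n + 1),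
        a j * a k * ∫ t in -π..π, cos ((j - k : ℤ) * t) * h t := by
  simp only [squareKernel_eq_sum_cos, Finset.sum_mul]
  rw [intervalIntegral.integral_finsetSum
    fun j _ => Continuous.intervalIntegrable (by fun_prop) _ _]
  refine Finset.sum_congr rfl fun j _ => ?_
  rw [intervalIntegral.integral_finsetSum
    fun k _ => Continuous.intervalIntegrable (by fun_prop) _ _]
  refine Finset.sum_congr rfl fun k _ => ?_
  simp only [mul_assoc, intervalIntegral.integral_const_mul]

theorem integral_squareKernel :
    ∫ t in -π..π, squareKernel a n t = 2 * π * ∑ j ∈ Finset.range (n + 1), a j ^ 2 := by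
  have expand := integral_squareKernel_mul a n (h := fun _ => 1) continuous_const
  simp only [mul_one, integral_cos_int_mul, sub_eq_zero, Nat.cast_inj, mul_ite, mul_zero,
    Finset.sum_ite_eq] at expand
  rw [expand, Finset.mul_sum]
  refine Finset.sum_congr rfl fun j hj => ?_
  rw [if_pos hj]
  ring

theorem integral_squareKernel_mul_cos :
    ∫ t in -π..π, squareKernel a n t * cos t =
      2 * π * ∑ j ∈ Finset.range n, a j * a (j + 1) := by
  have eq_one_iff : ∀ j k : ℕ, (j : ℤ) - k = 1 ↔ j = k + 1 := by omega
  have eq_neg_one_iff : ∀ j k : ℕ, (j : ℤ) - k = -1 ↔ k = j + 1 := by omega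
  have swap : ∑ j ∈ Finset.range (n + 1), ∑ k ∈ Finset.range (n + 1),
      (if k = j + 1 then a j * a k else 0) = ∑ k ∈ Finset.range n, a k * a (k + 1) := by
    rw [← sum_range_sum_range_ite_eq_succ, Finset.sum_comm]
    simp only [mul_comm]
  have split (j k : ℕ) : a j * a k * ∫ t in -π..π, cos ((j - k : ℤ) * t) * cos t =
      π * (if j = k + 1 then a j * a k else 0) + π * if k = j + 1 then a j * a k else 0 := by
    rw [integral_cos_int_mul_mul_cos]
    simp only [eq_one_iff, eq_neg_one_iff]
    split_ifs <;> ring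
  rw [integral_squareKernel_mul a n continuous_cos]
  simp only [split, Finset.sum_add_distrib, ← Finset.mul_sum, sum_range_sum_range_ite_eq_succ, swap]
  ring

theorem integral_squareKernel_mul_sin_half_sq :
    ∫ t in -π..π, squareKernel a n t * sin (t / 2) ^ 2 =
      π * (∑ j ∈ Finset.range (n + 1), a j ^ 2 - ∑ j ∈ Finset.range n, a j * a (j + 1)) := by
  have half_angle : ∀ t : ℝ, squareKernel a n t * sin (t / 2) ^ 2 =
      1 / 2 * squareKernel a n t - 1 / 2 * (squareKernel a n t * cos t) := by
    intro t
    rw [sin_sq_eq_half_sub, mul_div_cancel₀ t two_ne_zero]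
    ring
  simp only [half_angle]
  rw [intervalIntegral.integral_sub (Continuous.intervalIntegrable (by fun_prop) _ _)
    (Continuous.intervalIntegrable (by fun_prop) _ _), intervalIntegral.integral_const_mul,
    intervalIntegral.integral_const_mul, integral_squareKernel, integral_squareKernel_mul_cos]
  ring

theorem integral_squareKernel_mul_abs_sin_half_le :
    ∫ t in -π..π, squareKernel a n t * |sin (t / 2)| ≤
      √(2 * π * ∑ j ∈ Finset.range (n + 1), a j ^ 2) *
        √(π * (∑ j ∈ Finset.range (n + 1), a j ^ 2 - ∑ j ∈ Finset.range n, a j * a (j + 1))) := by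
  have memLp {h : ℝ → ℝ} (hh : Continuous h) : MemLp h 2 (volume.restrict (Set.Ioc (-π) π)) :=
    (memLp_two_iff_integrable_sq hh.aestronglyMeasurable).2 (hh.pow 2).integrableOn_Ioc
  have sqrt_kernel_sq (t : ℝ) : √(squareKernel a n t) ^ 2 = squareKernel a n t :=
    sq_sqrt (squareKernel_nonneg a n t)
  have cauchy_schwarz := integral_mul_le_sqrt_mul_sqrt
    (memLp (h := fun t => √(squareKernel a n t)) (by fun_prop))
    (memLp (h := fun t => √(squareKernel a n t) * |sin (t / 2)|) (by fun_prop))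
  simpa only [← mul_assoc, ← sq, mul_pow, sq_abs, sqrt_kernel_sq,
    ← intervalIntegral.integral_of_le (neg_le_self pi_pos.le), integral_squareKernel,
    integral_squareKernel_mul_sin_half_sq] using cauchy_schwarz

theorem sum_mul_succ_eq_mul_sum_sq {w : ℕ → ℝ} {n : ℕ} {c : ℝ} (first : w 0 = 0)
    (last : w (n + 2) = 0) (recurrence : ∀ j, w (j + 2) + w j = 2 * c * w (j + 1)) :
    ∑ j ∈ Finset.range n, w (j + 1) * w (j + 2) =
      c * ∑ j ∈ Finset.range (n + 1), w (j + 1) ^ 2 := by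
  have upper : ∑ j ∈ Finset.range (n + 1), w (j + 1) * w (j + 2) =
      ∑ j ∈ Finset.range n, w (j + 1) * w (j + 2) := by
    rw [Finset.sum_range_succ, last, mul_zero, add_zero]
  have lower : ∑ j ∈ Finset.range (n + 1), w (j + 1) * w j =
      ∑ j ∈ Finset.range n, w (j + 1) * w (j + 2) := by
    rw [Finset.sum_range_succ', first, mul_zero, add_zero]
    exact Finset.sum_congr rfl fun _ _ => mul_comm _ _
  have total : ∑ j ∈ Finset.range (n + 1), w (j + 1) * (w (j + 2) + w j) =
      2 * c * ∑ j ∈ Finset.range (n + 1), w (j + 1) ^ 2 := by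
    rw [Finset.mul_sum]
    refine Finset.sum_congr rfl fun j _ => ?_
    rw [recurrence]
    ring
  simp only [mul_add, Finset.sum_add_distrib, upper, lower] at total
  linarith

-- The weights are the normalized sines `sin ((j + 1) π / (n + 2))` of Fejér and Korovkin.
theorem exists_sum_sq_eq_one_and_sum_mul_succ_eq_cos :
    ∃ a : ℕ → ℝ, ∑ j ∈ Finset.range (n + 1), a j ^ 2 = 1 ∧
      ∑ j ∈ Finset.range n, a j * a (j + 1) = cos (π / (n + 2)) := by
  set w : ℕ → ℝ := fun j => sin (j * (π / (n + 2))) with hw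
  have w_zero : w 0 = 0 := by simp [hw]
  have w_last : w (n + 2) = 0 := by
    have : (n + 2 : ℝ) ≠ 0 := by positivity
    simp [hw, mul_div_cancel₀ π this]
  have w_one_pos : 0 < w 1 := by
    refine sin_pos_of_pos_of_lt_pi (by positivity) ?_
    rw [Nat.cast_one, one_mul, div_lt_iff₀ (by positivity)]
    nlinarith [pi_pos]
  have recurrence (j : ℕ) : w (j + 2) + w j = 2 * cos (π / (n + 2)) * w (j + 1) := by
    simp only [hw]
    push_cast
    rw [show ((j : ℝ) + 2) * (π / (n + 2)) = (j + 1) * (π / (n + 2)) + π / (n + 2) by ring,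
      show (j : ℝ) * (π / (n + 2)) = (j + 1) * (π / (n + 2)) - π / (n + 2) by ring, sin_add,
      sin_sub]
    ring
  have correlation := sum_mul_succ_eq_mul_sum_sq w_zero w_last recurrence
  set S := ∑ j ∈ Finset.range (n + 1), w (j + 1) ^ 2
  have S_pos : 0 < S :=
    Finset.sum_pos' (fun _ _ => sq_nonneg _) ⟨0, by simp, pow_pos w_one_pos 2⟩
  refine ⟨fun j => w (j + 1) / √S, ?_, ?_⟩
  · simp only [div_pow, sq_sqrt S_pos.le, ← Finset.sum_div]
    exact div_self S_pos.ne'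
  · simp only [div_mul_div_comm, mul_self_sqrt S_pos.le, ← Finset.sum_div]
    rw [correlation, mul_div_cancel_right₀ _ S_pos.ne']

theorem exists_sum_sq_eq_one_and_integral_squareKernel_mul_abs_sin_half_le :
    ∃ a : ℕ → ℝ, ∑ j ∈ Finset.range (n + 1), a j ^ 2 = 1 ∧
      ∫ t in -π..π, squareKernel a n t * |sin (t / 2)| ≤ π ^ 2 / (n + 2) := by
  obtain ⟨a, ha, correlation⟩ := exists_sum_sq_eq_one_and_sum_mul_succ_eq_cos n
  set φ := π / (n + 2) with hφ
  have φ_nonneg : 0 ≤ φ := by positivity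
  have φ_le : φ ≤ 2 * π := by
    rw [hφ, div_le_iff₀ (by positivity)]
    nlinarith [pi_pos]
  refine ⟨a, ha, (integral_squareKernel_mul_abs_sin_half_le a n).trans ?_⟩
  rw [ha, correlation, mul_one]
  calc √(2 * π) * √(π * (1 - cos φ)) = 2 * π * √((1 - cos φ) / 2) := by
        rw [← sqrt_mul (by positivity), ← sqrt_sq (by positivity : 0 ≤ 2 * π),
          ← sqrt_mul (by positivity), sqrt_sq (by positivity)]
        ring_nf
    _ = 2 * π * sin (φ / 2) := by rw [sin_half_eq_sqrt φ_nonneg φ_le]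
    _ ≤ 2 * π * (φ / 2) := by gcongr; exact sin_le (by positivity)
    _ = π ^ 2 / (n + 2) := by rw [hφ]; ring

end Kernel

section CosLift

theorem abs_sin_two_mul_add_le (a b : ℝ) : |sin (2 * a + b)| ≤ 2 * |sin a| + |sin b| := by
  have bound_left : |cos a| * |cos b| ≤ 1 := mul_le_one₀ (abs_cos_le_one a) (abs_nonneg _)
    (abs_cos_le_one b)
  calc |sin (2 * a + b)| = |2 * sin a * (cos a * cos b) + cos (2 * a) * sin b| := by
        rw [sin_add, sin_two_mul, mul_assoc (2 * sin a)]
    _ ≤ 2 * |sin a| * (|cos a| * |cos b|) + |cos (2 * a)| * |sin b| := by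
        refine (abs_add_le _ _).trans_eq ?_
        simp only [abs_mul, Nat.abs_ofNat]
    _ ≤ 2 * |sin a| * 1 + 1 * |sin b| := by
        gcongr
        exact abs_cos_le_one _
    _ = 2 * |sin a| + |sin b| := by ring

theorem one_sub_cos_div_two_mem_Icc (θ : ℝ) : (1 - cos θ) / 2 ∈ Set.Icc (0 : ℝ) 1 :=
  ⟨by linarith [cos_le_one θ], by linarith [neg_one_le_cos θ]⟩

/-- The even `2π`-periodic function on the line corresponding to a function on `[0, 1]` under the
substitution `x = (1 - cos θ) / 2`. -/
noncomputable def cosLift (f : ℝ → ℝ) (θ : ℝ) : ℝ := f ((1 - cos θ) / 2)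

/-- The cosine Fourier coefficients of `cosLift f`, normalized so that they are the averages of
`cosLift f θ * cos (m θ)` over a period. -/
noncomputable def cosCoeff (f : ℝ → ℝ) (m : ℤ) : ℝ :=
  (2 * π)⁻¹ * ∫ s in -π..π, cosLift f s * cos (m * s)

theorem cosLift_neg (f : ℝ → ℝ) (θ : ℝ) : cosLift f (-θ) = cosLift f θ := by
  simp only [cosLift, cos_neg]

theorem cosLift_periodic (f : ℝ → ℝ) : Function.Periodic (cosLift f) (2 * π) := by
  intro θ
  simp only [cosLift, cos_add_two_pi]

theorem cosLift_zero {f : ℝ → ℝ} (h₀ : f 0 = 0) : cosLift f 0 = 0 := by simp [cosLift, h₀]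

theorem integral_cosLift_mul_sin (f : ℝ → ℝ) (m : ℝ) :
    ∫ s in -π..π, cosLift f s * sin (m * s) = 0 := by
  have odd := intervalIntegral.integral_comp_neg (a := -π) (b := π)
    (fun s => cosLift f s * sin (m * s))
  simp only [cosLift_neg, mul_neg, sin_neg, intervalIntegral.integral_neg, neg_neg] at odd
  linarith

variable {f : ℝ → ℝ} {L : ℝ≥0}

theorem continuous_cosLift (hf : ContinuousOn f (Set.Icc 0 1)) : Continuous (cosLift f) :=
  hf.comp_continuous (by fun_prop) one_sub_cos_div_two_mem_Icc

theorem abs_cosLift_sub_le (hf : LipschitzOnWith L f (Set.Icc 0 1)) (a b : ℝ) :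
    |cosLift f a - cosLift f b| ≤ L * (|sin ((a + b) / 2)| * |sin ((a - b) / 2)|) := by
  have difference : (1 - cos a) / 2 - (1 - cos b) / 2 = sin ((a + b) / 2) * sin ((a - b) / 2) := by
    linear_combination (-1 / 2) * cos_sub_cos a b
  simpa only [dist_eq, difference, abs_mul, cosLift] using
    hf.dist_le_mul _ (one_sub_cos_div_two_mem_Icc a) _ (one_sub_cos_div_two_mem_Icc b)

theorem abs_cosLift_le (hf : LipschitzOnWith L f (Set.Icc 0 1)) (h₀ : f 0 = 0) (θ : ℝ) :
    |cosLift f θ| ≤ L := by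
  have from_zero := abs_cosLift_sub_le hf θ 0
  rw [cosLift_zero h₀, sub_zero, add_zero, sub_zero] at from_zero
  exact from_zero.trans (mul_le_of_le_one_right L.coe_nonneg
    (mul_le_one₀ (abs_sin_le_one _) (abs_nonneg _) (abs_sin_le_one _)))

theorem abs_cosLift_add_sub_sub_le (hf : LipschitzOnWith L f (Set.Icc 0 1)) (θ t : ℝ) :
    |cosLift f (t + θ) - cosLift f t - (cosLift f θ - cosLift f 0)| ≤
      4 * L * |sin (θ / 2)| * |sin (t / 2)| := by
  wlog smaller : |sin (θ / 2)| ≤ |sin (t / 2)| generalizing θ t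
  · convert this t θ (le_of_not_ge smaller) using 1
    · rw [add_comm, sub_sub_sub_comm, sub_sub_sub_comm, sub_right_comm]
    · ring
  have shift : |cosLift f (t + θ) - cosLift f t| ≤
      L * ((2 * |sin (t / 2)| + |sin (θ / 2)|) * |sin (θ / 2)|) := by
    refine (abs_cosLift_sub_le hf (t + θ) t).trans ?_
    rw [add_sub_cancel_left, show (t + θ + t) / 2 = 2 * (t / 2) + θ / 2 by ring]
    gcongr
    exact abs_sin_two_mul_add_le _ _
  have at_zero : |cosLift f θ - cosLift f 0| ≤ L * (|sin (θ / 2)| * |sin (θ / 2)|) := by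
    simpa only [add_zero, sub_zero] using abs_cosLift_sub_le hf θ 0
  calc |cosLift f (t + θ) - cosLift f t - (cosLift f θ - cosLift f 0)|
      ≤ 2 * L * |sin (θ / 2)| * (|sin (t / 2)| + |sin (θ / 2)|) := by
        linarith [abs_sub (cosLift f (t + θ) - cosLift f t) (cosLift f θ - cosLift f 0)]
    _ ≤ 2 * L * |sin (θ / 2)| * (|sin (t / 2)| + |sin (t / 2)|) := by gcongr
    _ = 4 * L * |sin (θ / 2)| * |sin (t / 2)| := by ring

theorem abs_cosCoeff_le (hf : LipschitzOnWith L f (Set.Icc 0 1)) (h₀ : f 0 = 0) (m : ℤ) :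
    |cosCoeff f m| ≤ L := by
  have bound := intervalIntegral.norm_integral_le_of_norm_le_const (a := -π) (b := π)
    (f := fun s => cosLift f s * cos (m * s)) (C := L) fun s _ => by
      rw [norm_eq_abs, abs_mul]
      exact (mul_le_of_le_one_right (abs_nonneg _) (abs_cos_le_one _)).trans
        (abs_cosLift_le hf h₀ s)
  rw [norm_eq_abs, sub_neg_eq_add, ← two_mul, abs_of_pos two_pi_pos] at bound
  rw [cosCoeff, abs_mul, abs_inv, abs_of_pos two_pi_pos, inv_mul_le_iff₀ two_pi_pos]
  linarith

theorem integral_cos_mul_cosLift_add (hf : ContinuousOn f (Set.Icc 0 1)) (m : ℤ) (θ : ℝ) :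
    ∫ t in -π..π, cos (m * t) * cosLift f (t + θ) = 2 * π * (cosCoeff f m * cos (m * θ)) := by
  have continuous := continuous_cosLift hf
  have periodic : Function.Periodic (fun s => cos (m * (s - θ)) * cosLift f s) (2 * π) := by
    intro s
    simp only [cosLift_periodic f s, add_sub_right_comm, mul_add, cos_add_int_mul_two_pi]
  have expand (s : ℝ) : cos (m * (s - θ)) * cosLift f s =
      cosLift f s * cos (m * s) * cos (m * θ) + cosLift f s * sin (m * s) * sin (m * θ) := by
    rw [mul_sub, cos_sub]
    ring
  calc ∫ t in -π..π, cos (m * t) * cosLift f (t + θ)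
      = ∫ s in (-π + θ)..(-π + θ + 2 * π), cos (m * (s - θ)) * cosLift f s := by
        rw [show -π + θ + 2 * π = π + θ by ring, ← intervalIntegral.integral_comp_add_right
          (fun s => cos (m * (s - θ)) * cosLift f s)]
        simp only [add_sub_cancel_right]
    _ = ∫ s in -π..π, cos (m * (s - θ)) * cosLift f s := by
        rw [periodic.intervalIntegral_add_eq _ (-π), show -π + 2 * π = π by ring]
    _ = (∫ s in -π..π, cosLift f s * cos (m * s)) * cos (m * θ) := by
        simp only [expand]
        rw [intervalIntegral.integral_add (Continuous.intervalIntegrable (by fun_prop) _ _)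
          (Continuous.intervalIntegrable (by fun_prop) _ _), intervalIntegral.integral_mul_const,
          intervalIntegral.integral_mul_const, integral_cosLift_mul_sin, zero_mul, add_zero]
    _ = 2 * π * (cosCoeff f m * cos (m * θ)) := by
        rw [cosCoeff, mul_assoc (2 * π)⁻¹, mul_inv_cancel_left₀ two_pi_pos.ne']

end CosLift

section Jackson

variable {f : ℝ → ℝ} {L : ℝ≥0} (a : ℕ → ℝ) (n : ℕ)

/-- The convolution of `cosLift f` with the kernel `squareKernel a n`, averaged over a period, as a
polynomial of degree at most `n` in the variable `x = (1 - cos θ) / 2`: the Jackson-type approximant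
of `f` on `[0, 1]`. -/
noncomputable def jacksonPolynomial (f : ℝ → ℝ) : ℝ[X] :=
  ∑ j ∈ Finset.range (n + 1), ∑ k ∈ Finset.range (n + 1),
    C (a j * a k * cosCoeff f (j - k)) * (Chebyshev.T ℝ (j - k : ℤ)).comp (1 - 2 * X)

theorem natDegree_jacksonPolynomial_le (f : ℝ → ℝ) : (jacksonPolynomial a n f).natDegree ≤ n := by
  have linear : (1 - 2 * X : ℝ[X]).natDegree ≤ 1 := by compute_degree
  refine natDegree_sum_le_of_forall_le _ _ fun j hj => natDegree_sum_le_of_forall_le _ _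
    fun k hk => (natDegree_C_mul_le _ _).trans (natDegree_comp_le.trans ?_)
  rw [Finset.mem_range] at hj hk
  rw [Chebyshev.natDegree_T]
  exact (Nat.mul_le_mul_left _ linear).trans (by omega)

theorem eval_jacksonPolynomial (hf : ContinuousOn f (Set.Icc 0 1)) (θ : ℝ) :
    (jacksonPolynomial a n f).eval ((1 - cos θ) / 2) =
      (2 * π)⁻¹ * ∫ t in -π..π, squareKernel a n t * cosLift f (t + θ) := by
  have continuous := continuous_cosLift hf
  have substitution : (1 - 2 * X : ℝ[X]).eval ((1 - cos θ) / 2) = cos θ := by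
    simp only [eval_sub, eval_one, eval_mul, eval_ofNat, eval_X]
    ring
  rw [integral_squareKernel_mul a n (by fun_prop), jacksonPolynomial, Finset.mul_sum,
    eval_finsetSum]
  refine Finset.sum_congr rfl fun j _ => ?_
  rw [Finset.mul_sum, eval_finsetSum]
  refine Finset.sum_congr rfl fun k _ => ?_
  rw [eval_mul, eval_C, eval_comp, substitution, Chebyshev.T_real_cos,
    integral_cos_mul_cosLift_add hf, mul_left_comm (a j * a k), inv_mul_cancel_left₀ two_pi_pos.ne',
    mul_assoc]

variable {a n}

theorem abs_coeff_jacksonPolynomial_le (ha : ∑ j ∈ Finset.range (n + 1), a j ^ 2 = 1)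
    (hf : LipschitzOnWith L f (Set.Icc 0 1)) (h₀ : f 0 = 0) (i : ℕ) :
    |(jacksonPolynomial a n f).coeff i| ≤ L * 14 ^ n := by
  have term_le : ∀ j ∈ Finset.range (n + 1), ∀ k ∈ Finset.range (n + 1),
      |(C (a j * a k * cosCoeff f (j - k)) *
        (Chebyshev.T ℝ (j - k : ℤ)).comp (1 - 2 * X)).coeff i| ≤ |a j| * |a k| * (L * 7 ^ n) := by
    intro j hj k hk
    rw [Finset.mem_range] at hj hk
    rw [coeff_C_mul, abs_mul, abs_mul, abs_mul, mul_assoc, ← Chebyshev.T_natAbs]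
    gcongr
    · exact abs_cosCoeff_le hf h₀ _
    · refine (abs_coeff_chebyshev_T_comp_le_seven_pow _ i).trans ?_
      exact pow_le_pow_right₀ (by norm_num) (by omega)
  have sum_le : (∑ j ∈ Finset.range (n + 1), |a j|) ^ 2 ≤ 2 ^ n := by
    refine sq_sum_le_card_mul_sum_sq.trans ?_
    simp only [sq_abs, ha, mul_one, Finset.card_range]
    exact_mod_cast Nat.lt_two_pow_self
  calc |(jacksonPolynomial a n f).coeff i|
      ≤ ∑ j ∈ Finset.range (n + 1), ∑ k ∈ Finset.range (n + 1), |a j| * |a k| * (L * 7 ^ n) := by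
        simp only [jacksonPolynomial, finsetSum_coeff]
        exact (Finset.abs_sum_le_sum_abs _ _).trans (Finset.sum_le_sum fun j hj =>
          (Finset.abs_sum_le_sum_abs _ _).trans (Finset.sum_le_sum fun k hk => term_le j hj k hk))
    _ = (∑ j ∈ Finset.range (n + 1), |a j|) ^ 2 * (L * 7 ^ n) := by
        rw [sq, Finset.sum_mul_sum]
        simp only [Finset.sum_mul]
    _ ≤ 2 ^ n * (L * 7 ^ n) := by gcongr
    _ = L * 14 ^ n := by rw [mul_left_comm, ← mul_pow]; norm_num

theorem cosLift_sub_eval_jacksonPolynomial (ha : ∑ j ∈ Finset.range (n + 1), a j ^ 2 = 1)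
    (hf : ContinuousOn f (Set.Icc 0 1)) (θ : ℝ) :
    cosLift f θ - cosLift f 0 -
        ((jacksonPolynomial a n f).eval ((1 - cos θ) / 2) - (jacksonPolynomial a n f).eval 0) =
      -((2 * π)⁻¹ * ∫ t in -π..π, squareKernel a n t *
        (cosLift f (t + θ) - cosLift f t - (cosLift f θ - cosLift f 0))) := by
  have continuous := continuous_cosLift hf
  have eval_zero := eval_jacksonPolynomial a n hf 0
  simp only [cos_zero, sub_self, zero_div, add_zero] at eval_zero
  simp_rw [mul_sub (squareKernel a n _) (_ - _) (_ - _), mul_sub _ (cosLift f (_ + θ))]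
  rw [intervalIntegral.integral_sub (Continuous.intervalIntegrable (by fun_prop) _ _)
    (Continuous.intervalIntegrable (by fun_prop) _ _),
    intervalIntegral.integral_sub (Continuous.intervalIntegrable (by fun_prop) _ _)
    (Continuous.intervalIntegrable (by fun_prop) _ _), intervalIntegral.integral_mul_const,
    integral_squareKernel, ha, eval_jacksonPolynomial a n hf, eval_zero]
  field_simp
  ring

theorem abs_cosLift_sub_eval_jacksonPolynomial_le
    (ha : ∑ j ∈ Finset.range (n + 1), a j ^ 2 = 1) (hf : LipschitzOnWith L f (Set.Icc 0 1))
    (θ : ℝ) :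
    |cosLift f θ - cosLift f 0 -
        ((jacksonPolynomial a n f).eval ((1 - cos θ) / 2) - (jacksonPolynomial a n f).eval 0)| ≤
      2 * L / π * |sin (θ / 2)| * ∫ t in -π..π, squareKernel a n t * |sin (t / 2)| := by
  have continuous := continuous_cosLift hf.continuousOn
  have neg_pi_le : -π ≤ π := neg_le_self pi_pos.le
  rw [cosLift_sub_eval_jacksonPolynomial ha hf.continuousOn, abs_neg, abs_mul,
    abs_of_pos (inv_pos.2 two_pi_pos), inv_mul_le_iff₀ two_pi_pos]
  calc |∫ t in -π..π, squareKernel a n t *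
        (cosLift f (t + θ) - cosLift f t - (cosLift f θ - cosLift f 0))|
      ≤ ∫ t in -π..π, |squareKernel a n t *
        (cosLift f (t + θ) - cosLift f t - (cosLift f θ - cosLift f 0))| :=
        intervalIntegral.abs_integral_le_integral_abs neg_pi_le
    _ ≤ ∫ t in -π..π, 4 * L * |sin (θ / 2)| * (squareKernel a n t * |sin (t / 2)|) := by
        refine intervalIntegral.integral_mono_on neg_pi_le
          (Continuous.intervalIntegrable (by fun_prop) _ _)
          (Continuous.intervalIntegrable (by fun_prop) _ _) fun t _ => ?_
        rw [abs_mul, abs_of_nonneg (squareKernel_nonneg a n t), mul_left_comm]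
        exact mul_le_mul_of_nonneg_left (abs_cosLift_add_sub_sub_le hf θ t)
          (squareKernel_nonneg a n t)
    _ = 2 * π * (2 * L / π * |sin (θ / 2)| *
        ∫ t in -π..π, squareKernel a n t * |sin (t / 2)|) := by
        rw [intervalIntegral.integral_const_mul]
        field_simp
        ring

theorem abs_sin_arccos_half {x : ℝ} (hx : x ∈ Set.Icc (0 : ℝ) 1) :
    |sin (arccos (1 - 2 * x) / 2)| = √x := by
  rw [← sqrt_sq_eq_abs, sin_sq_eq_half_sub, mul_div_cancel₀ _ two_ne_zero,
    cos_arccos (by linarith [hx.2]) (by linarith [hx.1])]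
  congr 1
  ring

theorem exists_polynomial_approx_unit (hf : LipschitzOnWith L f (Set.Icc 0 1)) (h₀ : f 0 = 0)
    (n : ℕ) :
    ∃ P : ℝ[X], P.natDegree ≤ n ∧ P.coeff 0 = 0 ∧ (∀ k, |P.coeff k| ≤ L * 14 ^ n) ∧
      ∀ x ∈ Set.Icc (0 : ℝ) 1, |f x - P.eval x| ≤ 2 * π * L * √x / (n + 2) := by
  obtain ⟨a, ha, concentrated⟩ :=
    exists_sum_sq_eq_one_and_integral_squareKernel_mul_abs_sin_half_le n
  set Q := jacksonPolynomial a n f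
  refine ⟨Q - C (Q.coeff 0), ?_, by simp, fun k => ?_, fun x hx => ?_⟩
  · rw [natDegree_sub_C]
    exact natDegree_jacksonPolynomial_le a n f
  · rcases k with _ | k
    · simp only [coeff_sub, coeff_C_zero, sub_self, abs_zero]
      positivity
    · rw [coeff_sub, coeff_C_succ, sub_zero]
      exact abs_coeff_jacksonPolynomial_le ha hf h₀ _
  · have cos_arccos_x : (1 - cos (arccos (1 - 2 * x))) / 2 = x := by
      rw [cos_arccos (by linarith [hx.2]) (by linarith [hx.1])]
      ring
    have error := abs_cosLift_sub_eval_jacksonPolynomial_le ha hf (arccos (1 - 2 * x))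
    rw [cosLift_zero h₀, sub_zero, cosLift, cos_arccos_x, abs_sin_arccos_half hx] at error
    rw [eval_sub, eval_C, coeff_zero_eq_eval_zero]
    calc |f x - (Q.eval x - Q.eval 0)|
        ≤ 2 * L / π * √x * ∫ t in -π..π, squareKernel a n t * |sin (t / 2)| := error
      _ ≤ 2 * L / π * √x * (π ^ 2 / (n + 2)) := by gcongr
      _ = 2 * π * L * √x / (n + 2) := by field_simp

theorem exists_polynomial_approx {B : ℝ} (hB : 0 < B) (hf : LipschitzOnWith L f (Set.Icc 0 B))
    (h₀ : f 0 = 0) (n : ℕ) :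
    ∃ P : ℝ[X], P.natDegree ≤ n ∧ P.coeff 0 = 0 ∧
      (∀ k, |P.coeff k| ≤ L * B * 14 ^ n * B⁻¹ ^ k) ∧
      ∀ x ∈ Set.Icc (0 : ℝ) B, |f x - P.eval x| ≤ 2 * π * L * √(B * x) / (n + 2) := by
  have scaled : LipschitzOnWith (L * B.toNNReal) (fun y => f (B * y)) (Set.Icc 0 1) := by
    refine hf.comp (LipschitzWith.of_dist_le_mul fun y z => ?_).lipschitzOnWith fun y hy =>
      ⟨mul_nonneg hB.le hy.1, mul_le_of_le_one_right hB.le hy.2⟩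
    rw [dist_eq, dist_eq, ← mul_sub, abs_mul, abs_of_pos hB, coe_toNNReal _ hB.le]
  obtain ⟨P, degree, vanishes, coeff_le, approx⟩ :=
    exists_polynomial_approx_unit scaled (by rw [mul_zero, h₀]) n
  simp only [NNReal.coe_mul, coe_toNNReal B hB.le] at coeff_le approx
  refine ⟨P.comp (C B⁻¹ * X), ?_, ?_, fun k => ?_, fun x hx => ?_⟩
  · have linear : (C B⁻¹ * X : ℝ[X]).natDegree ≤ 1 := (natDegree_C_mul_le _ _).trans natDegree_X_le
    exact natDegree_comp_le.trans ((Nat.mul_le_mul_left _ linear).trans (by rwa [mul_one]))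
  · rw [comp_C_mul_X_coeff, vanishes, zero_mul]
  · rw [comp_C_mul_X_coeff, abs_mul, abs_of_pos (pow_pos (inv_pos.2 hB) k)]
    gcongr
    exact coeff_le k
  · have rescaled := approx (B⁻¹ * x)
      ⟨mul_nonneg (inv_pos.2 hB).le hx.1, (inv_mul_le_one₀ hB).2 hx.2⟩
    have sqrt_scaling : B * √(B⁻¹ * x) = √(B * x) := by
      rw [← sqrt_sq hB.le, ← sqrt_mul (sq_nonneg B), sqrt_sq hB.le, sq, mul_assoc,
        mul_inv_cancel_left₀ hB.ne']
    rw [mul_inv_cancel_left₀ hB.ne', ← mul_assoc (2 * π), mul_assoc _ B, sqrt_scaling] at rescaled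
    simpa only [eval_comp, eval_mul, eval_C, eval_X] using rescaled

end Jackson

section MomentComparison

theorem integrable_of_ae_mem_isCompact {X : Type*} [TopologicalSpace X] [MeasurableSpace X]
    [OpensMeasurableSpace X] [SecondCountableTopology X] [T2Space X] {μ : Measure X}
    [IsFiniteMeasureOnCompacts μ] {s : Set X} (hs : IsCompact s) (hμ : ∀ᵐ x ∂μ, x ∈ s)
    {f : X → ℝ} (hf : ContinuousOn f s) : Integrable f μ := by
  rw [← Measure.restrict_eq_self_of_ae_mem hμ]
  exact hf.integrableOn_compact hs

theorem integral_sqrt_le_sqrt_mul_integral {Ω : Type*} [MeasurableSpace Ω] {μ : Measure Ω}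
    [IsFiniteMeasure μ] {f : Ω → ℝ} (hf : Integrable f μ) (nonneg : 0 ≤ᵐ[μ] f) :
    ∫ x, √(f x) ∂μ ≤ √(μ.real Set.univ * ∫ x, f x ∂μ) := by
  have sq_sqrt_eq : (fun x => √(f x) ^ 2) =ᵐ[μ] f := nonneg.mono fun x hx => sq_sqrt hx
  have memLp_sqrt : MemLp (fun x => √(f x)) 2 μ :=
    (memLp_two_iff_integrable_sq (continuous_sqrt.comp_aestronglyMeasurable
      hf.aestronglyMeasurable)).2 (hf.congr sq_sqrt_eq.symm)
  have cauchy_schwarz := integral_mul_le_sqrt_mul_sqrt (memLp_const (1 : ℝ)) memLp_sqrt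
  simpa only [one_mul, one_pow, integral_const, smul_eq_mul, mul_one, integral_congr_ae sq_sqrt_eq,
    ← sqrt_mul measureReal_nonneg] using cauchy_schwarz

variable {μ ν : Measure ℝ} [IsFiniteMeasure μ] [IsFiniteMeasure ν] {B : ℝ} {f : ℝ → ℝ} {L : ℝ≥0}

theorem abs_integral_sub_integral_eval_le (hμ : ∀ᵐ x ∂μ, x ∈ Set.Icc 0 B) (hB : 0 ≤ B)
    (hf : ContinuousOn f (Set.Icc 0 B)) {P : ℝ[X]} {c : ℝ}
    (approx : ∀ x ∈ Set.Icc (0 : ℝ) B, |f x - P.eval x| ≤ c * √(B * x)) :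
    |∫ x, f x ∂μ - ∫ x, P.eval x ∂μ| ≤ c * √B * ∫ x, √x ∂μ := by
  have integrable {h : ℝ → ℝ} (hh : ContinuousOn h (Set.Icc 0 B)) : Integrable h μ :=
    integrable_of_ae_mem_isCompact isCompact_Icc hμ hh
  rw [← integral_sub (integrable hf) (integrable P.continuousOn), ← integral_const_mul]
  refine abs_integral_le_integral_abs.trans (integral_mono_ae
    (integrable (hf.sub P.continuousOn).abs) (integrable (by fun_prop)) (hμ.mono fun x hx => ?_))
  simpa only [mul_assoc, ← sqrt_mul hB] using approx x hx

theorem integral_eval_eq_sum_coeff_mul_moment (hμ : ∀ᵐ x ∂μ, x ∈ Set.Icc 0 B) {P : ℝ[X]} {n : ℕ}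
    (degree : P.natDegree ≤ n) (vanishes : P.coeff 0 = 0) :
    ∫ x, P.eval x ∂μ = ∑ k ∈ Finset.Icc 1 n, P.coeff k * ∫ x, x ^ k ∂μ := by
  simp only [eval_eq_sum_range' (Nat.lt_succ_of_le degree), Finset.sum_range_succ', vanishes,
    zero_mul, add_zero]
  rw [integral_finsetSum _ fun k _ =>
    integrable_of_ae_mem_isCompact isCompact_Icc hμ (by fun_prop)]
  simp only [integral_const_mul]
  rw [Finset.range_eq_Ico, Finset.sum_Ico_add' (fun k => P.coeff k * ∫ x, x ^ k ∂μ) 0 n 1]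
  rfl

theorem abs_integral_sub_integral_le (hB : 0 < B) (hμ : ∀ᵐ x ∂μ, x ∈ Set.Icc 0 B)
    (hν : ∀ᵐ x ∂ν, x ∈ Set.Icc 0 B) (hf : LipschitzOnWith L f (Set.Icc 0 B)) (h₀ : f 0 = 0)
    (n : ℕ) :
    |∫ x, f x ∂μ - ∫ x, f x ∂ν| ≤
      2 * π * L / (n + 2) * √B * (∫ x, √x ∂μ + ∫ x, √x ∂ν) +
        L * B * 14 ^ n * ∑ k ∈ Finset.Icc 1 n, B⁻¹ ^ k * |∫ x, x ^ k ∂μ - ∫ x, x ^ k ∂ν| := by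
  obtain ⟨P, degree, vanishes, coeff_le, approx⟩ := exists_polynomial_approx hB hf h₀ n
  simp only [mul_div_right_comm _ √_] at approx
  have approx_μ := abs_integral_sub_integral_eval_le hμ hB.le hf.continuousOn approx
  have approx_ν := abs_integral_sub_integral_eval_le hν hB.le hf.continuousOn approx
  have moments : |∫ x, P.eval x ∂μ - ∫ x, P.eval x ∂ν| ≤
      L * B * 14 ^ n * ∑ k ∈ Finset.Icc 1 n, B⁻¹ ^ k * |∫ x, x ^ k ∂μ - ∫ x, x ^ k ∂ν| := by
    rw [integral_eval_eq_sum_coeff_mul_moment hμ degree vanishes,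
      integral_eval_eq_sum_coeff_mul_moment hν degree vanishes, ← Finset.sum_sub_distrib,
      Finset.mul_sum]
    refine (Finset.abs_sum_le_sum_abs _ _).trans (Finset.sum_le_sum fun k _ => ?_)
    rw [← mul_sub, abs_mul, ← mul_assoc]
    gcongr
    exact coeff_le k
  rw [abs_sub_comm] at approx_ν
  linarith [abs_sub_le (∫ x, f x ∂μ) (∫ x, P.eval x ∂μ) (∫ x, f x ∂ν),
    abs_sub_le (∫ x, P.eval x ∂μ) (∫ x, P.eval x ∂ν) (∫ x, f x ∂ν)]

end MomentComparison

section Quantile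

open Filter Topology

variable {μ ν : Measure ℝ}

theorem monotone_real_Iic (μ : Measure ℝ) [IsFiniteMeasure μ] :
    Monotone fun x => μ.real (Set.Iic x) :=
  fun _ _ hxy => measureReal_mono (Set.Iic_subset_Iic.2 hxy)

theorem tendsto_real_Iic_nhdsGT (μ : Measure ℝ) [IsFiniteMeasure μ] (x : ℝ) :
    Tendsto (fun y => μ.real (Set.Iic y)) (𝓝[>] x) (𝓝 (μ.real (Set.Iic x))) := by
  have inter : ⋂ r > x, Set.Iic r = Set.Iic x := by
    ext y
    simp only [Set.mem_iInter, Set.mem_Iic]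
    exact ⟨le_of_forall_gt_imp_ge_of_dense, fun h r hr => h.trans hr.le⟩
  have from_above := tendsto_measure_biInter_gt (μ := μ) (s := Set.Iic) (a := x)
    (fun _ _ => measurableSet_Iic.nullMeasurableSet) (fun _ _ _ hij => Set.Iic_subset_Iic.2 hij)
    ⟨x + 1, lt_add_one x, measure_ne_top _ _⟩
  rw [inter] at from_above
  exact (ENNReal.tendsto_toReal (measure_ne_top _ _)).comp from_above

theorem tendsto_real_Iic_atBot (μ : Measure ℝ) [IsFiniteMeasure μ] :
    Tendsto (fun y => μ.real (Set.Iic y)) atBot (𝓝 0) := by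
  have to_empty := tendsto_measure_iInter_atBot (μ := μ) (s := Set.Iic)
    (fun _ => measurableSet_Iic.nullMeasurableSet) monotone_Iic ⟨(0 : ℝ), measure_ne_top _ _⟩
  have inter : ⋂ x : ℝ, Set.Iic x = ∅ :=
    Set.eq_empty_of_forall_notMem fun x hx =>
      (sub_one_lt x).not_ge (Set.mem_iInter.1 hx (x - 1))
  rw [inter, measure_empty] at to_empty
  exact (ENNReal.tendsto_toReal ENNReal.zero_ne_top).comp to_empty

theorem exists_le_real_Iic [IsFiniteMeasure μ] {t : ℝ} (ht : t < μ.real Set.univ) :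
    ∃ b, t ≤ μ.real (Set.Iic b) :=
  (((ENNReal.tendsto_toReal (measure_ne_top μ _)).comp
    (tendsto_measure_Iic_atTop μ)).eventually_const_le ht).exists

theorem quantile_le_iff [IsFiniteMeasure μ] {t b : ℝ} (t_pos : 0 < t)
    (ht : t ≤ μ.real (Set.Iic b)) (x : ℝ) : quantile μ t ≤ x ↔ t ≤ μ.real (Set.Iic x) := by
  have bounded : BddBelow {y : ℝ | t ≤ μ.real (Set.Iic y)} := by
    obtain ⟨c, hc⟩ := ((tendsto_real_Iic_atBot μ).eventually_lt_const t_pos).exists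
    exact ⟨c, fun y hy => le_of_not_gt fun hyc =>
      (hy.trans (monotone_real_Iic μ hyc.le)).not_gt hc⟩
  refine ⟨fun h => ge_of_tendsto (tendsto_real_Iic_nhdsGT μ x) ?_, fun h => csInf_le bounded h⟩
  refine eventually_of_mem self_mem_nhdsWithin fun r hr => ?_
  obtain ⟨y, hy, hyr⟩ := exists_lt_of_csInf_lt ⟨b, ht⟩ (h.trans_lt hr)
  exact hy.trans (monotone_real_Iic μ hyr.le)

theorem quantile_mono [IsFiniteMeasure μ] {s t b : ℝ} (s_pos : 0 < s) (hst : s ≤ t)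
    (ht : t ≤ μ.real (Set.Iic b)) : quantile μ s ≤ quantile μ t :=
  (quantile_le_iff s_pos (hst.trans ht) _).2
    (hst.trans ((quantile_le_iff (s_pos.trans_le hst) ht _).1 le_rfl))

theorem aemeasurable_quantile (μ : Measure ℝ) [IsFiniteMeasure μ] :
    AEMeasurable (quantile μ) (volume.restrict (Set.Ioo 0 (μ.real Set.univ))) :=
  aemeasurable_restrict_of_monotoneOn measurableSet_Ioo fun _ hs _ ht hst =>
    quantile_mono hs.1 hst (exists_le_real_Iic ht.2).choose_spec

theorem map_quantile (μ : Measure ℝ) [IsFiniteMeasure μ] :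
    (volume.restrict (Set.Ioo 0 (μ.real Set.univ))).map (quantile μ) = μ := by
  refine Measure.ext_of_Iic _ _ fun x => ?_
  have preimage : quantile μ ⁻¹' Set.Iic x ∩ Set.Ioo 0 (μ.real Set.univ) =
      Set.Ioc 0 (μ.real (Set.Iic x)) ∩ Set.Iio (μ.real Set.univ) := by
    ext t
    constructor
    · rintro ⟨h, t_pos, ht⟩
      exact ⟨⟨t_pos, (quantile_le_iff t_pos (exists_le_real_Iic ht).choose_spec x).1 h⟩, ht⟩
    · rintro ⟨⟨t_pos, h⟩, ht⟩
      exact ⟨(quantile_le_iff t_pos h x).2 h, t_pos, ht⟩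
  have le_total : μ.real (Set.Iic x) ≤ μ.real Set.univ := measureReal_mono (Set.subset_univ _)
  have ae_eq : (Set.Ioc 0 (μ.real (Set.Iic x)) ∩ Set.Iio (μ.real Set.univ) : Set ℝ) =ᵐ[volume]
      Set.Ioc 0 (μ.real (Set.Iic x)) := by
    have subset : Set.Ioc 0 (μ.real (Set.Iic x)) ⊆ Set.Iic (μ.real Set.univ) :=
      Set.Ioc_subset_Iic_self.trans (Set.Iic_subset_Iic.2 le_total)
    conv_rhs => rw [← Set.inter_eq_left.2 subset]
    exact (ae_eq_refl _).inter Iio_ae_eq_Iic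
  rw [Measure.map_apply_of_aemeasurable (aemeasurable_quantile μ) measurableSet_Iic,
    Measure.restrict_apply' measurableSet_Ioo, preimage, measure_congr ae_eq, volume_Ioc, sub_zero,
    ofReal_measureReal]

theorem intervalIntegrable_comp_quantile [IsFiniteMeasure μ] {f : ℝ → ℝ} (hf : Integrable f μ) :
    IntervalIntegrable (fun t => f (quantile μ t)) volume 0 (μ.real Set.univ) := by
  rw [intervalIntegrable_iff_integrableOn_Ioo_of_le measureReal_nonneg]
  have hf' := hf
  rw [← map_quantile μ] at hf'
  exact (integrable_map_measure hf'.aestronglyMeasurable (aemeasurable_quantile μ)).1 hf'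

theorem integral_comp_quantile [IsFiniteMeasure μ] {f : ℝ → ℝ} (hf : AEStronglyMeasurable f μ) :
    ∫ t in 0..μ.real Set.univ, f (quantile μ t) = ∫ x, f x ∂μ := by
  have hf' := hf
  rw [← map_quantile μ] at hf'
  rw [intervalIntegral.integral_of_le measureReal_nonneg, integral_Ioc_eq_integral_Ioo,
    ← integral_map (aemeasurable_quantile μ) hf', map_quantile]

theorem exists_lipschitzWith_sub_eq {F G : ℝ → ℝ} (hF : Measurable F) (hG : Measurable G) :
    ∃ f : ℝ → ℝ, LipschitzWith 1 f ∧ f 0 = 0 ∧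
      (∀ a b, a ≤ b → (∀ x ∈ Set.Ioo a b, F x < G x) → f b - f a = b - a) ∧
      ∀ a b, a ≤ b → (∀ x ∈ Set.Ioo a b, G x ≤ F x) → f a - f b = b - a := by
  set s : ℝ → ℝ := fun x => if F x < G x then 1 else -1 with s_def
  have s_measurable : Measurable s :=
    Measurable.ite (measurableSet_lt hF hG) measurable_const measurable_const
  have norm_s_le (x : ℝ) : ‖s x‖ ≤ 1 := by
    simp only [s_def]
    split_ifs <;> simp
  have integrable (a b : ℝ) : IntervalIntegrable s volume a b :=
    (intervalIntegrable_const (c := (1 : ℝ))).mono_fun s_measurable.aestronglyMeasurable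
      (Eventually.of_forall fun x => by simpa using norm_s_le x)
  have increment (a b : ℝ) : (∫ x in 0..b, s x) - ∫ x in 0..a, s x = ∫ x in a..b, s x :=
    intervalIntegral.integral_interval_sub_left (integrable _ _) (integrable _ _)
  have integral_of_const {a b c : ℝ} (hab : a ≤ b) (h : ∀ x ∈ Set.Ioo a b, s x = c) :
      ∫ x in a..b, s x = (b - a) * c := by
    rw [intervalIntegral.integral_of_le hab, integral_Ioc_eq_integral_Ioo,
      setIntegral_congr_fun measurableSet_Ioo h]
    simp [hab]
  refine ⟨fun b => ∫ x in 0..b, s x, LipschitzWith.of_dist_le_mul fun a b => ?_, by simp,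
    fun a b hab h => ?_, fun a b hab h => ?_⟩
  · rw [dist_eq, dist_eq, increment, ← norm_eq_abs]
    exact intervalIntegral.norm_integral_le_of_norm_le_const fun x _ => norm_s_le x
  · rw [increment, integral_of_const hab fun x hx => if_pos (h x hx), mul_one]
  · rw [← neg_sub, increment, integral_of_const hab fun x hx => if_neg (h x hx).not_gt]
    ring

theorem exists_lipschitzWith_integral_abs_quantile_sub_eq [IsFiniteMeasure μ] [IsFiniteMeasure ν]
    (mass : μ.real Set.univ = ν.real Set.univ) (hμ : Integrable id μ) (hν : Integrable id ν) :
    ∃ f : ℝ → ℝ, LipschitzWith 1 f ∧ f 0 = 0 ∧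
      ∫ t in 0..μ.real Set.univ, |quantile μ t - quantile ν t| = ∫ x, f x ∂μ - ∫ x, f x ∂ν := by
  obtain ⟨f, lipschitz, f_zero, increasing, decreasing⟩ := exists_lipschitzWith_sub_eq
    (monotone_real_Iic μ).measurable (monotone_real_Iic ν).measurable
  have integrable {ρ : Measure ℝ} (hρ : Integrable id ρ) : Integrable f ρ := by
    refine hρ.mono lipschitz.continuous.aestronglyMeasurable (Eventually.of_forall fun x => ?_)
    simpa [dist_eq, f_zero] using lipschitz.dist_le_mul x 0
  have pointwise : ∀ t ∈ Set.Ioo 0 (μ.real Set.univ),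
      |quantile μ t - quantile ν t| = f (quantile μ t) - f (quantile ν t) := by
    intro t ht
    obtain ⟨b, hb⟩ := exists_le_real_Iic ht.2
    obtain ⟨c, hc⟩ := exists_le_real_Iic (mass ▸ ht.2)
    have level_μ := quantile_le_iff ht.1 hb
    have level_ν := quantile_le_iff ht.1 hc
    rcases le_total (quantile ν t) (quantile μ t) with hle | hle
    · rw [abs_of_nonneg (sub_nonneg.2 hle), increasing _ _ hle fun x hx => ?_]
      exact (not_le.1 fun h => hx.2.not_ge ((level_μ x).2 h)).trans_le ((level_ν x).1 hx.1.le)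
    · rw [abs_of_nonpos (sub_nonpos.2 hle), neg_sub, decreasing _ _ hle fun x hx => ?_]
      exact (not_le.1 fun h => hx.2.not_ge ((level_ν x).2 h)).le.trans ((level_μ x).1 hx.1.le)
  refine ⟨f, lipschitz, f_zero, ?_⟩
  rw [← integral_comp_quantile (integrable hμ).aestronglyMeasurable,
    ← integral_comp_quantile (integrable hν).aestronglyMeasurable, ← mass,
    ← intervalIntegral.integral_sub (intervalIntegrable_comp_quantile (integrable hμ))
      (mass ▸ intervalIntegrable_comp_quantile (integrable hν)),
    intervalIntegral.integral_of_le measureReal_nonneg,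
    intervalIntegral.integral_of_le measureReal_nonneg, integral_Ioc_eq_integral_Ioo,
    integral_Ioc_eq_integral_Ioo, setIntegral_congr_fun measurableSet_Ioo pointwise]

end Quantile

section BoundedSupport

variable {μ : Measure ℝ} {B : ℝ}

theorem quantile_zero (μ : Measure ℝ) : quantile μ 0 = 0 := by
  simp [quantile]

theorem real_Iic_eq_real_univ (hμ : ∀ᵐ x ∂μ, x ≤ B) : μ.real (Set.Iic B) = μ.real Set.univ :=
  measureReal_congr (Filter.eventuallyEq_univ.2 hμ)

theorem quantile_mem_Icc [IsFiniteMeasure μ] (hB : 0 ≤ B) (hμ : ∀ᵐ x ∂μ, x ∈ Set.Icc 0 B) {t : ℝ}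
    (ht : t ∈ Set.Icc 0 (μ.real Set.univ)) : quantile μ t ∈ Set.Icc 0 B := by
  rcases ht.1.eq_or_lt with rfl | t_pos
  · simpa [quantile_zero] using hB
  have level : t ≤ μ.real (Set.Iic B) :=
    ht.2.trans_eq (real_Iic_eq_real_univ (hμ.mono fun x hx => hx.2)).symm
  refine ⟨Real.sInf_nonneg fun x hx => le_of_not_gt fun x_neg => ?_,
    (quantile_le_iff t_pos level B).2 level⟩
  have real_Iic_x : μ.real (Set.Iic x) = 0 := by
    have ae_empty : Set.Iic x =ᵐ[μ] (∅ : Set ℝ) := Filter.eventuallyEq_empty.2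
      (hμ.mono fun y hy hyx => (hy.1.trans hyx).not_gt x_neg)
    rw [measureReal_congr ae_empty, measureReal_empty]
  exact (t_pos.trans_le hx).ne' real_Iic_x

theorem monotoneOn_quantile [IsFiniteMeasure μ] (hB : 0 ≤ B) (hμ : ∀ᵐ x ∂μ, x ∈ Set.Icc 0 B) :
    MonotoneOn (quantile μ) (Set.Icc 0 (μ.real Set.univ)) := by
  intro s hs t ht hst
  rcases hs.1.eq_or_lt with rfl | s_pos
  · rw [quantile_zero]
    exact (quantile_mem_Icc hB hμ ht).1
  · exact quantile_mono s_pos hst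
      (ht.2.trans_eq (real_Iic_eq_real_univ (hμ.mono fun x hx => hx.2)).symm)

end BoundedSupport

section Rounding

variable {d : ℕ} {μ : Measure ℝ} [IsFiniteMeasure μ] {B : ℝ}

theorem level_mem_Icc (i : Fin d) (v : unitInterval) :
    (d : ℝ) - 1 - i + v ∈ Set.Icc (0 : ℝ) d := by
  have succ_le : (i : ℝ) + 1 ≤ d := by exact_mod_cast i.isLt
  exact ⟨by linarith [v.2.1], by linarith [v.2.2, (i : ℕ).cast_nonneg (α := ℝ)]⟩

theorem round_mem_Icc (mass : μ.real Set.univ = d) (hB : 0 ≤ B) (hμ : ∀ᵐ x ∂μ, x ∈ Set.Icc 0 B)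
    (u : Fin d → unitInterval) (i : Fin d) : round d μ u i ∈ Set.Icc 0 B :=
  quantile_mem_Icc hB hμ (mass ▸ level_mem_Icc i (u i))

theorem measurable_round (mass : μ.real Set.univ = d) (hB : 0 ≤ B)
    (hμ : ∀ᵐ x ∂μ, x ∈ Set.Icc 0 B) : Measurable (round d μ) := by
  refine measurable_pi_lambda _ fun i => ?_
  have monotone : Monotone fun v : unitInterval => quantile μ ((d : ℝ) - 1 - i + v) :=
    fun v w hvw => monotoneOn_quantile hB hμ (mass ▸ level_mem_Icc i v) (mass ▸ level_mem_Icc i w)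
      (add_le_add_right (Subtype.coe_le_coe.2 hvw) _)
  exact monotone.measurable.comp (measurable_pi_apply i)

theorem antitone_round (mass : μ.real Set.univ = d) (hB : 0 ≤ B)
    (hμ : ∀ᵐ x ∂μ, x ∈ Set.Icc 0 B) (u : Fin d → unitInterval) : Antitone (round d μ u) := by
  intro i j hij
  rcases hij.eq_or_lt with rfl | hlt
  · exact le_rfl
  · refine monotoneOn_quantile hB hμ (mass ▸ level_mem_Icc j (u j))
      (mass ▸ level_mem_Icc i (u i)) ?_
    have succ_le : (i : ℝ) + 1 ≤ j := by exact_mod_cast hlt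
    linarith [(u i).2.1, (u j).2.2]

theorem integrable_dTV_round (mass : μ.real Set.univ = d) (hB : 0 ≤ B)
    (hμ : ∀ᵐ x ∂μ, x ∈ Set.Icc 0 B) (α : Fin d → ℝ) :
    Integrable fun u : Fin d → unitInterval => dTV (round d μ u) α := by
  refine (integrable_finsetSum _ fun i _ => Integrable.abs ?_).const_mul _
  refine (Integrable.of_bound (C := B) ?_ (Filter.Eventually.of_forall fun u => ?_)).sub
    (integrable_const (α i))
  · exact (measurable_pi_iff.1 (measurable_round mass hB hμ) i).aestronglyMeasurable
  · have mem := round_mem_Icc mass hB hμ u i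
    exact (norm_of_nonneg mem.1).trans_le mem.2

theorem measurePreserving_level (i : Fin d) :
    MeasurePreserving (fun u : Fin d → unitInterval => (d : ℝ) - 1 - i + u i) volume
      (volume.restrict (Set.Ioc ((d : ℝ) - 1 - i) (d - 1 - i + 1))) := by
  have shift := (measurePreserving_add_left volume ((d : ℝ) - 1 - i)).restrict_preimage
    (measurableSet_Icc (a := (d : ℝ) - 1 - i) (b := d - 1 - i + 1))
  rw [Set.preimage_const_add_Icc, sub_self, add_sub_cancel_left] at shift
  rw [restrict_Ioc_eq_restrict_Icc]
  exact shift.comp (unitInterval.measurePreserving_coe.comp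
    (measurePreserving_eval (fun _ : Fin d => (volume : Measure unitInterval)) i))

theorem integral_sum_comp_level {g : ℝ → ℝ} (hg : IntervalIntegrable g volume 0 d) :
    ∫ u : Fin d → unitInterval, ∑ i, g ((d : ℝ) - 1 - i + u i) = ∫ t in 0..(d : ℝ), g t := by
  have piece (k : ℕ) (hk : k < d) : IntervalIntegrable g volume k (k + 1 : ℕ) := by
    refine hg.mono_set ?_
    rw [Set.uIcc_of_le (by simp), Set.uIcc_of_le d.cast_nonneg]
    exact Set.Icc_subset_Icc k.cast_nonneg (by exact_mod_cast hk)
  have cast_rev (i : Fin d) : ((d - 1 - i : ℕ) : ℝ) = d - 1 - i := by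
    have lt := i.isLt
    rw [Nat.cast_sub (by omega), Nat.cast_sub (by omega), Nat.cast_one]
  have integrable (i : Fin d) :
      Integrable g (volume.restrict (Set.Ioc ((d : ℝ) - 1 - i) (d - 1 - i + 1))) := by
    have rev_lt : d - 1 - (i : ℕ) < d := by omega
    have piece_rev := (piece _ rev_lt).1
    rwa [Nat.cast_succ, cast_rev] at piece_rev
  have adjacent := intervalIntegral.sum_integral_adjacent_intervals
    (a := fun k : ℕ => (k : ℝ)) (n := d) piece
  rw [Nat.cast_zero, ← Finset.sum_range_reflect, ← Fin.sum_univ_eq_sum_range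
    (fun j => ∫ t in ((d - 1 - j : ℕ) : ℝ)..(d - 1 - j + 1 : ℕ), g t)] at adjacent
  have integrable_comp (i : Fin d) :
      Integrable fun u : Fin d → unitInterval => g ((d : ℝ) - 1 - i + u i) :=
    (measurePreserving_level i).integrable_comp_of_integrable (integrable i)
  rw [integral_finsetSum _ fun i _ => integrable_comp i, ← adjacent]
  refine Finset.sum_congr rfl fun i _ => ?_
  have level := measurePreserving_level i
  rw [Nat.cast_succ, cast_rev, intervalIntegral.integral_of_le (by linarith), ← level.map_eq,
    integral_map level.aemeasurable (level.map_eq ▸ (integrable i).aestronglyMeasurable)]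

/-- The measure `∑ i, δ_{α i}`, whose moments are the power sums of `α`. It is not normalized: its
total mass is the length of `α`. -/
noncomputable def empiricalMeasure (α : Fin d → ℝ) : Measure ℝ :=
  ∑ i, Measure.dirac (α i)

instance (α : Fin d → ℝ) : IsFiniteMeasure (empiricalMeasure α) := by
  unfold empiricalMeasure
  infer_instance

theorem integral_empiricalMeasure (α : Fin d → ℝ) (f : ℝ → ℝ) :
    ∫ x, f x ∂(empiricalMeasure α) = ∑ i, f (α i) := by
  rw [empiricalMeasure, integral_finsetSum_measure fun i _ => integrable_dirac (by simp)]
  simp only [integral_dirac]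

theorem real_Iic_empiricalMeasure (α : Fin d → ℝ) (x : ℝ) :
    (empiricalMeasure α).real (Set.Iic x) = (Finset.univ.filter fun j => α j ≤ x).card := by
  simp [empiricalMeasure, measureReal_def, Set.indicator_apply]

theorem sub_le_real_Iic_empiricalMeasure {α : Fin d → ℝ} (hα : Antitone α) (i : Fin d) :
    (d : ℝ) - i ≤ (empiricalMeasure α).real (Set.Iic (α i)) := by
  have subset : Finset.Ici i ⊆ Finset.univ.filter fun j => α j ≤ α i := fun j hj => by
    simpa using hα (Finset.mem_Ici.1 hj)
  rw [real_Iic_empiricalMeasure, ← Nat.cast_sub i.isLt.le, ← Fin.card_Ici]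
  exact_mod_cast Finset.card_le_card subset

theorem real_Iic_empiricalMeasure_le_sub {α : Fin d → ℝ} (hα : Antitone α) (i : Fin d) {x : ℝ}
    (hx : x < α i) : (empiricalMeasure α).real (Set.Iic x) ≤ (d : ℝ) - 1 - i := by
  have subset : (Finset.univ.filter fun j => α j ≤ x) ⊆ Finset.Ioi i := fun j hj =>
    Finset.mem_Ioi.2 (lt_of_not_ge fun hji =>
      ((hα hji).trans (Finset.mem_filter.1 hj).2).not_gt hx)
  have card_le := Finset.card_le_card subset
  rw [Fin.card_Ioi] at card_le
  rw [real_Iic_empiricalMeasure, sub_sub, le_sub_iff_add_le]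
  exact_mod_cast (by omega :
    (Finset.univ.filter fun j => α j ≤ x).card + (1 + (i : ℕ)) ≤ d)

theorem round_empiricalMeasure {α : Fin d → ℝ} (hα : Antitone α) {u : Fin d → unitInterval}
    (hu : ∀ i, u i ≠ 0) : round d (empiricalMeasure α) u = α := by
  funext i
  have seed_pos : (0 : ℝ) < u i := unitInterval.coe_pos.2 (unitInterval.pos_iff_ne_zero.2 (hu i))
  have lower : (d : ℝ) - 1 - i < d - 1 - i + u i := lt_add_of_pos_right _ seed_pos
  have succ_le : (i : ℝ) + 1 ≤ d := by exact_mod_cast i.isLt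
  have upper : (d : ℝ) - 1 - i + u i ≤ (empiricalMeasure α).real (Set.Iic (α i)) := by
    linarith [(u i).2.2, sub_le_real_Iic_empiricalMeasure hα i]
  have level_iff := quantile_le_iff (by linarith) upper
  refine le_antisymm ((level_iff _).2 upper) (le_of_not_gt fun hlt => ?_)
  exact (lower.trans_le ((level_iff _).1 le_rfl)).not_ge (real_Iic_empiricalMeasure_le_sub hα i hlt)

theorem integral_dTV_round (mass : μ.real Set.univ = d) (hμ : Integrable id μ) {α : Fin d → ℝ}
    (hα : Antitone α) :
    ∫ u : Fin d → unitInterval, dTV (round d μ u) α =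
      1 / 2 * ∫ t in 0..(d : ℝ), |quantile μ t - quantile (empiricalMeasure α) t| := by
  have mass_α : (empiricalMeasure α).real Set.univ = d := by
    simp [empiricalMeasure, measureReal_def]
  have integrable_α : Integrable id (empiricalMeasure α) :=
    integrable_finsetSum_measure.2 fun i _ => integrable_dirac (by simp)
  have seed_ne_zero : ∀ᵐ u : Fin d → unitInterval, ∀ i, u i ≠ 0 :=
    ae_all_iff.2 fun i => Measure.ae_eval_ne _ i 0
  have integrable : IntervalIntegrable
      (fun t => quantile μ t - quantile (empiricalMeasure α) t) volume 0 d :=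
    (mass ▸ intervalIntegrable_comp_quantile hμ).sub
      (mass_α ▸ intervalIntegrable_comp_quantile integrable_α)
  rw [← integral_sum_comp_level integrable.abs, ← integral_const_mul]
  refine integral_congr_ae (seed_ne_zero.mono fun u hu => ?_)
  nth_rewrite 1 [← round_empiricalMeasure hα hu]
  rfl

end Rounding

section LinearProgram

variable {d K : ℕ} {B : ℝ} {p V : ℕ → ℝ} {μ ν : Measure ℝ} {α : Fin d → ℝ}

namespace IsLPSolution

theorem measure_univ (h : IsLPSolution d B K p V μ) : μ Set.univ = d := by
  rw [← measure_add_measure_compl (measurableSet_Icc (a := (0 : ℝ)) (b := B)), h.mass,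
    h.supported, add_zero]

theorem isFiniteMeasure (h : IsLPSolution d B K p V μ) : IsFiniteMeasure μ :=
  ⟨h.measure_univ ▸ ENNReal.natCast_lt_top d⟩

theorem real_univ (h : IsLPSolution d B K p V μ) : μ.real Set.univ = d := by
  rw [measureReal_def, h.measure_univ, ENNReal.toReal_natCast]

theorem ae_mem_Icc (h : IsLPSolution d B K p V μ) : ∀ᵐ x ∂μ, x ∈ Set.Icc 0 B :=
  h.supported

theorem integrable (h : IsLPSolution d B K p V μ) {f : ℝ → ℝ} (hf : Continuous f) :
    Integrable f μ :=
  have := h.isFiniteMeasure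
  integrable_of_ae_mem_isCompact isCompact_Icc h.ae_mem_Icc hf.continuousOn

theorem abs_sub_moment_le (h : IsLPSolution d B K p V μ) {k : ℕ} (hk : k ∈ Finset.Icc 1 K) :
    |p k - ∫ x, x ^ k ∂μ| ≤ V k := by
  have moment := h.moments k hk
  rwa [Measure.restrict_eq_self_of_ae_mem h.ae_mem_Icc] at moment

theorem V_nonneg (h : IsLPSolution d B K p V μ) (k : ℕ) (hk : k ∈ Finset.Icc 1 K) : 0 ≤ V k :=
  (abs_nonneg _).trans (h.moments k hk)

theorem abs_moment_sub_moment_le (hμ : IsLPSolution d B K p V μ) (hν : IsLPSolution d B K p V ν)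
    {k : ℕ} (hk : k ∈ Finset.Icc 1 K) : |∫ x, x ^ k ∂μ - ∫ x, x ^ k ∂ν| ≤ 2 * V k :=
  calc |∫ x, x ^ k ∂μ - ∫ x, x ^ k ∂ν|
      ≤ |∫ x, x ^ k ∂μ - p k| + |p k - ∫ x, x ^ k ∂ν| := abs_sub_le _ _ _
    _ ≤ V k + V k :=
      add_le_add (abs_sub_comm (p k) _ ▸ hμ.abs_sub_moment_le hk) (hν.abs_sub_moment_le hk)
    _ = 2 * V k := (two_mul _).symm

end IsLPSolution

theorem isLPSolution_empiricalMeasure (nonneg : ∀ i, 0 ≤ α i) (le_B : ∀ i, α i ≤ B)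
    (hp : ∀ k ∈ Finset.Icc 1 K, |p k - powerSum k α| ≤ V k) :
    IsLPSolution d B K p V (empiricalMeasure α) := by
  have supported : empiricalMeasure α (Set.Icc 0 B)ᶜ = 0 := by
    simp [empiricalMeasure, nonneg, le_B]
  have ae_mem_Icc : ∀ᵐ x ∂(empiricalMeasure α), x ∈ Set.Icc 0 B := supported
  refine ⟨supported, by simp [empiricalMeasure, nonneg, le_B], fun k hk => ?_⟩
  rw [Measure.restrict_eq_self_of_ae_mem ae_mem_Icc, integral_empiricalMeasure]
  exact hp k hk

/-- The term of the risk bound that accounts for the uncertainty `V` in the moments. -/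
noncomputable def momentError (B : ℝ) (K : ℕ) (V : ℕ → ℝ) : ℝ :=
  (2 : ℝ) ^ (9 * (K : ℝ) / 2) * B * ∑ k ∈ Finset.Icc 1 K, B ^ (-(k : ℤ)) * V k

theorem fourteen_pow_le_two_rpow (K : ℕ) : (14 : ℝ) ^ K ≤ 2 ^ (9 * (K : ℝ) / 2) :=
  calc (14 : ℝ) ^ K ≤ 16 ^ K := by gcongr; norm_num
    _ = 2 ^ (4 * (K : ℝ)) := by
      rw [rpow_mul zero_le_two, rpow_natCast]
      norm_num
    _ ≤ 2 ^ (9 * (K : ℝ) / 2) :=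
      rpow_le_rpow_of_exponent_le one_le_two (by linarith [K.cast_nonneg (α := ℝ)])

theorem fourteen_pow_mul_sum_le_momentError (hB : 0 < B) {m : ℕ → ℝ}
    (hm : ∀ k ∈ Finset.Icc 1 K, |m k| ≤ 2 * V k) :
    B * 14 ^ K * ∑ k ∈ Finset.Icc 1 K, B⁻¹ ^ k * |m k| ≤ 2 * momentError B K V := by
  calc B * 14 ^ K * ∑ k ∈ Finset.Icc 1 K, B⁻¹ ^ k * |m k|
      ≤ B * 2 ^ (9 * (K : ℝ) / 2) * ∑ k ∈ Finset.Icc 1 K, B⁻¹ ^ k * (2 * V k) := by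
        gcongr with k hk
        · exact fourteen_pow_le_two_rpow K
        · exact hm k hk
    _ = 2 * momentError B K V := by
        simp only [momentError, zpow_neg, zpow_natCast, inv_pow, Finset.mul_sum]
        exact Finset.sum_congr rfl fun k _ => by ring

theorem momentError_nonneg (hB : 0 ≤ B) (hV : ∀ k ∈ Finset.Icc 1 K, 0 ≤ V k) :
    0 ≤ momentError B K V :=
  mul_nonneg (by positivity)
    (Finset.sum_nonneg fun k hk => mul_nonneg (zpow_nonneg hB _) (hV k hk))

theorem apply_one_le_momentError (hB : 0 < B) (hK : 1 ≤ K) (hV : ∀ k ∈ Finset.Icc 1 K, 0 ≤ V k) :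
    V 1 ≤ momentError B K V := by
  have one_mem : 1 ∈ Finset.Icc 1 K := Finset.left_mem_Icc.2 hK
  have V_nonneg := hV 1 one_mem
  calc V 1 = 1 * B * (B ^ (-((1 : ℕ) : ℤ)) * V 1) := by
        rw [Nat.cast_one, zpow_neg_one]
        field_simp
    _ ≤ 2 ^ (9 * (K : ℝ) / 2) * B * (B ^ (-((1 : ℕ) : ℤ)) * V 1) := by
        gcongr
        exact one_le_rpow one_le_two (by positivity)
    _ ≤ momentError B K V := by
        unfold momentError
        gcongr
        exact Finset.single_le_sum (f := fun k : ℕ => B ^ (-(k : ℤ)) * V k)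
          (fun k hk => mul_nonneg (zpow_pos hB _).le (hV k hk)) one_mem

end LinearProgram

section Risk

variable {d K : ℕ} {B : ℝ} {p V : ℕ → ℝ} {μ : Measure ℝ} {α : Fin d → ℝ}

theorem integral_id_empiricalMeasure (α : Fin d → ℝ) :
    ∫ x, x ∂(empiricalMeasure α) = powerSum 1 α := by
  simp only [integral_empiricalMeasure, powerSum, pow_one]

namespace IsLPSolution

theorem integral_id_nonneg (h : IsLPSolution d B K p V μ) : 0 ≤ ∫ x, x ∂μ :=
  integral_nonneg_of_ae (h.ae_mem_Icc.mono fun _ hx => hx.1)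

theorem integral_id_le (hμ : IsLPSolution d B K p V μ)
    (hα : IsLPSolution d B K p V (empiricalMeasure α)) (hK : 1 ≤ K) :
    ∫ x, x ∂μ ≤ powerSum 1 α + 2 * V 1 := by
  have first_moment := hμ.abs_moment_sub_moment_le hα (Finset.left_mem_Icc.2 hK)
  simp only [pow_one, integral_id_empiricalMeasure] at first_moment
  linarith [(abs_le.1 first_moment).2]

theorem sqrt_mul_integral_sqrt_le (hμ : IsLPSolution d B K p V μ)
    (hα : IsLPSolution d B K p V (empiricalMeasure α)) (hK : 1 ≤ K) (hB : 0 ≤ B) :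
    √B * ∫ x, √x ∂μ ≤ √2 * √(B * d * (powerSum 1 α + V 1)) := by
  have := hμ.isFiniteMeasure
  have sqrt_le := integral_sqrt_le_sqrt_mul_integral (hμ.integrable continuous_id)
    (hμ.ae_mem_Icc.mono fun x hx => hx.1)
  simp only [id_eq, hμ.real_univ] at sqrt_le
  have powerSum_nonneg := hα.integral_id_nonneg
  rw [integral_id_empiricalMeasure] at powerSum_nonneg
  have first_moment : ∫ x, x ∂μ ≤ 2 * (powerSum 1 α + V 1) := by
    linarith [hμ.integral_id_le hα hK]
  calc √B * ∫ x, √x ∂μ ≤ √B * √(d * (2 * (powerSum 1 α + V 1))) := by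
        gcongr
        exact sqrt_le.trans (by gcongr)
    _ = √2 * √(B * d * (powerSum 1 α + V 1)) := by
        rw [← sqrt_mul hB, ← sqrt_mul zero_le_two]
        ring_nf

theorem exists_integral_dTV_round_eq (hμ : IsLPSolution d B K p V μ)
    (hα : IsLPSolution d B K p V (empiricalMeasure α)) (anti : Antitone α) :
    ∃ f : ℝ → ℝ, LipschitzWith 1 f ∧ f 0 = 0 ∧ ∫ u : Fin d → unitInterval, dTV (round d μ u) α =
      1 / 2 * (∫ x, f x ∂μ - ∫ x, f x ∂(empiricalMeasure α)) := by
  have := hμ.isFiniteMeasure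
  obtain ⟨f, lipschitz, f_zero, dual⟩ := exists_lipschitzWith_integral_abs_quantile_sub_eq
    (hμ.real_univ.trans hα.real_univ.symm) (hμ.integrable continuous_id)
    (hα.integrable continuous_id)
  rw [hμ.real_univ] at dual
  exact ⟨f, lipschitz, f_zero,
    dual ▸ integral_dTV_round hμ.real_univ (hμ.integrable continuous_id) anti⟩

theorem abs_integral_le_integral_id (h : IsLPSolution d B K p V μ) {f : ℝ → ℝ}
    (hf : LipschitzWith 1 f) (h₀ : f 0 = 0) : |∫ x, f x ∂μ| ≤ ∫ x, x ∂μ :=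
  abs_integral_le_integral_abs.trans <| integral_mono_ae (h.integrable hf.continuous.abs)
    (h.integrable continuous_id) <| h.ae_mem_Icc.mono fun x hx => by
      simpa [dist_eq, h₀, abs_of_nonneg hx.1] using hf.dist_le_mul x 0

theorem integral_dTV_round_le_powerSum_add (hμ : IsLPSolution d B K p V μ)
    (hα : IsLPSolution d B K p V (empiricalMeasure α)) (anti : Antitone α) (hK : 1 ≤ K) :
    ∫ u : Fin d → unitInterval, dTV (round d μ u) α ≤ powerSum 1 α + V 1 := by
  obtain ⟨f, lipschitz, f_zero, dual⟩ := hμ.exists_integral_dTV_round_eq hα anti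
  have upper := (abs_le.1 (hμ.abs_integral_le_integral_id lipschitz f_zero)).2
  have lower := (abs_le.1 (hα.abs_integral_le_integral_id lipschitz f_zero)).1
  rw [integral_id_empiricalMeasure] at lower
  linarith [hμ.integral_id_le hα hK]

theorem integral_dTV_round_le (hμ : IsLPSolution d B K p V μ)
    (hα : IsLPSolution d B K p V (empiricalMeasure α)) (anti : Antitone α) (hK : 1 ≤ K)
    (hB : 0 < B) :
    ∫ u : Fin d → unitInterval, dTV (round d μ u) α ≤
      10 * (√(B * d * (powerSum 1 α + V 1)) / K) + momentError B K V := by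
  have := hμ.isFiniteMeasure
  obtain ⟨f, lipschitz, f_zero, dual⟩ := hμ.exists_integral_dTV_round_eq hα anti
  have comparison := (le_abs_self _).trans (abs_integral_sub_integral_le hB hμ.ae_mem_Icc
    hα.ae_mem_Icc (lipschitz.lipschitzOnWith (s := Set.Icc 0 B)) f_zero K)
  rw [NNReal.coe_one, mul_one, one_mul] at comparison
  have moments := fourteen_pow_mul_sum_le_momentError hB
    fun k hk => hμ.abs_moment_sub_moment_le hα hk
  set W := √(B * d * (powerSum 1 α + V 1))
  have approximation : 2 * π / (K + 2) * √B * (∫ x, √x ∂μ + ∫ x, √x ∂(empiricalMeasure α)) ≤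
      20 * (W / K) :=
    calc 2 * π / (K + 2) * √B * (∫ x, √x ∂μ + ∫ x, √x ∂(empiricalMeasure α))
        = 2 * π / (K + 2) * (√B * ∫ x, √x ∂μ + √B * ∫ x, √x ∂(empiricalMeasure α)) := by ring
      _ ≤ 2 * π / (K + 2) * (√2 * W + √2 * W) :=
        mul_le_mul_of_nonneg_left (add_le_add (hμ.sqrt_mul_integral_sqrt_le hα hK hB.le)
          (hα.sqrt_mul_integral_sqrt_le hα hK hB.le)) (by positivity)
      _ = 4 * (π * √2) * (W / (K + 2)) := by ring
      _ ≤ 4 * (3.15 * (3 / 2)) * (W / K) := by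
        gcongr
        · exact pi_lt_d2.le
        · exact sqrt_le_left (by norm_num) |>.2 (by norm_num)
        · linarith
      _ ≤ 20 * (W / K) := by
        gcongr
        norm_num
  linarith

theorem integral_dTV_round_le_of_powerSum_le (hμ : IsLPSolution d B K p V μ)
    (hα : IsLPSolution d B K p V (empiricalMeasure α)) (anti : Antitone α) (hK : 1 ≤ K)
    (hB : 0 < B) (sum_le : powerSum 1 α ≤ 1) :
    ∫ u : Fin d → unitInterval, dTV (round d μ u) α ≤
      20 * (√(B * d) / K + momentError B K V) := by
  have V_one_le := apply_one_le_momentError hB hK hμ.V_nonneg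
  have error_nonneg := momentError_nonneg hB.le hμ.V_nonneg
  have main_nonneg : 0 ≤ √(B * d) / K := by positivity
  rcases le_total (V 1) 1 with V_le | V_ge
  · have sqrt_le : √(B * d * (powerSum 1 α + V 1)) ≤ √(B * d) * 2 := by
      rw [sqrt_mul (by positivity)]
      gcongr
      exact (sqrt_le_left zero_le_two).2 (by linarith)
    have div_le : √(B * d * (powerSum 1 α + V 1)) / K ≤ √(B * d) / K * 2 := by
      rw [div_mul_eq_mul_div]
      gcongr
    linarith [hμ.integral_dTV_round_le hα anti hK hB]
  · linarith [hμ.integral_dTV_round_le_powerSum_add hα anti hK]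

end IsLPSolution

end Risk

end LocalMomentMatching

theorem theorem7p1 :
    ∃ C : ℝ, 0 < C ∧
      ∀ (d K : ℕ) (B : ℝ) (p V : ℕ → ℝ) (α : Fin d → ℝ),
        1 ≤ K → 0 < B →
        Antitone α → (∀ i, 0 ≤ α i) → (∀ i, α i ≤ B) → ∑ i, α i ≤ 1 →
        (∀ k ∈ Finset.Icc 1 K, |p k - LocalMomentMatching.powerSum k α| ≤ V k) →
        -- the linear program has a solution ...
        (∃ μ : Measure ℝ, LocalMomentMatching.IsLPSolution d B K p V μ) ∧
        -- ... and, whichever solution is found, rounding it gives a good sorted estimate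
        ∀ μ : Measure ℝ, LocalMomentMatching.IsLPSolution d B K p V μ →
          Measurable (LocalMomentMatching.round d μ) ∧
          (∀ u, Antitone (LocalMomentMatching.round d μ u)) ∧
          Integrable (fun u : Fin d → unitInterval =>
            LocalMomentMatching.dTV (LocalMomentMatching.round d μ u) α) volume ∧
          ∫ u : Fin d → unitInterval,
              LocalMomentMatching.dTV (LocalMomentMatching.round d μ u) α
            ≤ C * (√(B * d) / K +
                (2 : ℝ) ^ (9 * (K : ℝ) / 2) * B *
                  ∑ k ∈ Finset.Icc 1 K, B ^ (-(k : ℤ)) * V k) ∧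
          ∫ u : Fin d → unitInterval,
              LocalMomentMatching.dTV (LocalMomentMatching.round d μ u) α
            ≤ C * (√(B * d * (LocalMomentMatching.powerSum 1 α + V 1)) / K +
                (2 : ℝ) ^ (9 * (K : ℝ) / 2) * B *
                  ∑ k ∈ Finset.Icc 1 K, B ^ (-(k : ℤ)) * V k) := by
  refine ⟨20, by norm_num, fun d K B p V α hK hB anti nonneg le_B sum_le hp => ?_⟩
  have hα := LocalMomentMatching.isLPSolution_empiricalMeasure nonneg le_B hp
  refine ⟨⟨_, hα⟩, fun μ hμ => ?_⟩
  have := hμ.isFiniteMeasure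
  have main_nonneg : 0 ≤ √(B * d * (LocalMomentMatching.powerSum 1 α + V 1)) / K := by positivity
  have error_nonneg := LocalMomentMatching.momentError_nonneg hB.le hμ.V_nonneg
  have powerSum_le : LocalMomentMatching.powerSum 1 α ≤ 1 := by
    simpa only [LocalMomentMatching.powerSum, pow_one] using sum_le
  have risk_le := hμ.integral_dTV_round_le hα anti hK hB
  unfold LocalMomentMatching.momentError at error_nonneg risk_le
  exact ⟨LocalMomentMatching.measurable_round hμ.real_univ hB.le hμ.ae_mem_Icc,
    LocalMomentMatching.antitone_round hμ.real_univ hB.le hμ.ae_mem_Icc,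
    LocalMomentMatching.integrable_dTV_round hμ.real_univ hB.le hμ.ae_mem_Icc α,
    hμ.integral_dTV_round_le_of_powerSum_le hα anti hK hB powerSum_le, by linarith⟩
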